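/- Call a field $K$ \emph{real} if $-1$ is not a sum of squares in $K$, and \emph{pythagorean} if every sum of squares in $K$ is a square in $K$. For a field $E$ with a fixed algebraic closure $\Omega$, the \emph{pythagorean closure} $E_{\mathrm{pyth}}\subseteq\Omega$ is the union of all fields $K_n$ that are reached by a finite chain $E=K_0\subseteq K_1\subseteq\dots\subseteq K_n\subseteq\Omega$ in which $K_{j+1}=K_j\big(\sqrt{a^2+b^2}\big)$ for some $a,b\in K_j$. \textbf{Theorem.} Let $E/\mathbb{Q}$ be a (possibly infinite) algebraic extension, and assume that $E$ is real but not pythagorean. Let $L/E_{\mathrm{pyth}}$ be a proper finite extension which can be written as a chain of field extensions $E_{\mathrm{pyth}}=F_0\subseteq F_1\subseteq\dots\subseteq F_n=L$ such that $[F_{i+1}:F_i]=2$ for some $0\le i<n$. Then $L$ is not pythagorean. -/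

import Mathlib

/-- A field is pythagorean if every sum of squares is a square. -/
def IsPythagoreanField (K : Type*) [Field K] : Prop :=
  ∀ x : K, IsSumSq x → IsSquare x

/-- `IsPythTower E Ω K` says that `K` is the top of a finite chain `E = K₀ ⊆ K₁ ⊆ ⋯ ⊆ Kₙ = K` of
subfields of `Ω` in which each `Kᵢ₊₁` is obtained from `Kᵢ` by adjoining a square root of a sum of
two squares of elements of `Kᵢ` (a step is trivial when the root already lies in `Kᵢ`). -/
inductive IsPythTower (E Ω : Type*) [Field E] [Field Ω] [Algebra E Ω] :
    IntermediateField E Ω → Prop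
  | base : IsPythTower E Ω ⊥
  | step (K : IntermediateField E Ω) (a b c : Ω) (hK : IsPythTower E Ω K)
      (ha : a ∈ K) (hb : b ∈ K) (hc : c ^ 2 = a ^ 2 + b ^ 2) :
      IsPythTower E Ω (K ⊔ IntermediateField.adjoin E {c})

/-- The pythagorean closure of `E` inside `Ω` (used for `Ω` an algebraic closure of `E`): the
compositum of all the finite towers above. The towers form a directed family, so this is their
union (direct limit), see `mem_pythClosure_iff`. -/
def pythClosure (E Ω : Type*) [Field E] [Field Ω] [Algebra E Ω] : IntermediateField E Ω :=
  sSup {K | IsPythTower E Ω K}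

theorem IsPythTower.sup {E Ω : Type*} [Field E] [Field Ω] [Algebra E Ω]
    {K M : IntermediateField E Ω} (hK : IsPythTower E Ω K) (hM : IsPythTower E Ω M) :
    IsPythTower E Ω (K ⊔ M) := by
  induction hM with
  | base => simpa using hK
  | step M a b c _ ha hb hc ih =>
    rw [← sup_assoc]
    exact .step (K ⊔ M) a b c ih (le_sup_right (a := K) ha) (le_sup_right (a := K) hb) hc

theorem mem_pythClosure_iff {E Ω : Type*} [Field E] [Field Ω] [Algebra E Ω] {x : Ω} :
    x ∈ pythClosure E Ω ↔ ∃ K : IntermediateField E Ω, IsPythTower E Ω K ∧ x ∈ K := by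
  have : Nonempty {K : IntermediateField E Ω // IsPythTower E Ω K} := ⟨⟨⊥, .base⟩⟩
  have hd : Directed (· ≤ ·)
      (fun K : {K : IntermediateField E Ω // IsPythTower E Ω K} => K.1) := fun K M =>
    ⟨⟨K.1 ⊔ M.1, K.2.sup M.2⟩, le_sup_left, le_sup_right⟩
  have h : pythClosure E Ω =
      ⨆ K : {K : IntermediateField E Ω // IsPythTower E Ω K}, K.1 := sSup_eq_iSup' _
  rw [h, ← SetLike.mem_coe, IntermediateField.coe_iSup_of_directed hd]
  simp

/-! Suppose `L` is pythagorean. By Diller–Dress the property descends to every field of the chain,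
so the quadratic step is `F(√a)/F` with both fields pythagorean and `a` a nonsquare, hence not a sum
of squares in `F`. By Artin, `a` is negative at some real embedding of `F`. Two facts about the
number of such embeddings collide. There is at most one: otherwise some `b` separates two of them
and is positive wherever `a` is, so `b` is a sum of squares, hence a square, in `F(√a)`; then `b` is
`x ^ 2` or `y ^ 2 * a` with `x`, `y` in `F`, and the signs of `b` exclude both. There are at least
two: a finite extension `N` of `E` containing `a` is not pythagorean, by Diller–Dress again, so `N ≠
F` and the embedding can be changed on `F` while kept on `N`; it stays real because square roots of
sums of two real squares are real. -/

/-! ### Orderings and Artin's theorem on sums of squares -/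

/-- Adjoining an element to a subsemiring of a commutative ring that contains all squares. -/
def Subsemiring.adjoinElement {R : Type*} [CommRing R] (T : Subsemiring R)
    (hT : ∀ z, z * z ∈ T) (x : R) : Subsemiring R where
  carrier := {z | ∃ u ∈ T, ∃ v ∈ T, z = u + x * v}
  zero_mem' := ⟨0, T.zero_mem, 0, T.zero_mem, by ring⟩
  one_mem' := ⟨1, T.one_mem, 0, T.zero_mem, by ring⟩
  add_mem' := by
    rintro _ _ ⟨u, hu, v, hv, rfl⟩ ⟨s, hs, t, ht, rfl⟩
    exact ⟨u + s, T.add_mem hu hs, v + t, T.add_mem hv ht, by ring⟩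
  mul_mem' := by
    rintro _ _ ⟨u, hu, v, hv, rfl⟩ ⟨s, hs, t, ht, rfl⟩
    exact ⟨u * s + x * x * (v * t),
      T.add_mem (T.mul_mem hu hs) (T.mul_mem (hT x) (T.mul_mem hv ht)),
      u * t + v * s, T.add_mem (T.mul_mem hu ht) (T.mul_mem hv hs), by ring⟩

/-- Solve `-1 = u + x * v` for `-x = (1 + u) / v`, and write `1 / v` as `v` times a square. -/
theorem Subsemiring.neg_mem_of_neg_one_mem_adjoinElement {K : Type*} [Field K]
    (T : Subsemiring K) (hT : ∀ z, z * z ∈ T) (h1 : -1 ∉ T) {x : K}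
    (h : -1 ∈ T.adjoinElement hT x) : -x ∈ T := by
  obtain ⟨u, hu, v, hv, huv⟩ := h
  have hv0 : v ≠ 0 := by
    rintro rfl
    exact h1 (by simpa [huv] using hu)
  have : -x = (1 + u) * v * (v⁻¹ * v⁻¹) := by
    field_simp
    linear_combination huv
  rw [this]
  exact T.mul_mem (T.mul_mem (T.add_mem T.one_mem hu) hv) (hT _)

/-- A proper preordering of a field extends to a total one. -/
theorem Subsemiring.exists_le_total {K : Type*} [Field K]
    (T : Subsemiring K) (hT : ∀ z, z * z ∈ T) (h1 : -1 ∉ T) :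
    ∃ C : Subsemiring K, T ≤ C ∧ -1 ∉ C ∧ (∀ z, z * z ∈ C) ∧ ∀ z, z ∈ C ∨ -z ∈ C := by
  obtain ⟨C, hTC, hC⟩ := zorn_le_nonempty₀
    {S : Subsemiring K | (∀ z, z * z ∈ S) ∧ -1 ∉ S} (by
      intro c hc hchain S hS
      refine ⟨sSup c, ⟨fun z => (le_sSup hS : S ≤ sSup c) ((hc hS).1 z), fun h => ?_⟩,
        fun z hz => le_sSup hz⟩
      rw [Subsemiring.mem_sSup_of_directedOn ⟨S, hS⟩ hchain.directedOn] at h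
      obtain ⟨U, hU, h⟩ := h
      exact (hc hU).2 h) T ⟨hT, h1⟩
  refine ⟨C, hTC, hC.prop.2, hC.prop.1, fun z => ?_⟩
  by_contra! hz
  have hle : C ≤ C.adjoinElement hC.prop.1 z :=
    fun u hu => ⟨u, hu, 0, C.zero_mem, by ring⟩
  by_cases h : -1 ∈ C.adjoinElement hC.prop.1 z
  · exact hz.2 (C.neg_mem_of_neg_one_mem_adjoinElement hC.prop.1 hC.prop.2 h)
  · exact hz.1 (hC.le_of_ge ⟨fun w => hle (hC.prop.1 w), h⟩ hle
      ⟨0, C.zero_mem, 1, C.one_mem, by ring⟩)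

/-- Cauchy's root bound: an element `x ≥ 1` is at most the sum of the absolute values of the lower
coefficients of its minimal polynomial, a rational number. -/
theorem archimedean_of_isAlgebraic_rat (K : Type*) [Field K] [LinearOrder K]
    [IsStrictOrderedRing K] (halg : ∀ x : K, IsAlgebraic ℚ x) : Archimedean K := by
  refine archimedean_iff_nat_le.2 fun x => ?_
  rcases le_total x 1 with hx | hx
  · exact ⟨1, by simpa using hx⟩
  set p := minpoly ℚ x
  have hp : p.Monic := minpoly.monic (halg x).isIntegral
  obtain ⟨m, hm⟩ : ∃ m, p.natDegree = m + 1 :=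
    Nat.exists_eq_succ_of_ne_zero (minpoly.natDegree_pos (halg x).isIntegral).ne'
  have h0 : Polynomial.aeval x p = 0 := minpoly.aeval ℚ x
  rw [hp.as_sum, hm] at h0
  simp only [map_add, map_pow, Polynomial.aeval_X, map_sum, map_mul, Polynomial.aeval_C] at h0
  have hx0 : (0 : K) < x := one_pos.trans_le hx
  have hle : x ^ (m + 1) ≤ (∑ i ∈ Finset.range (m + 1), |p.coeff i| : ℚ) * x ^ m := by
    have h2 : x ^ (m + 1) = ∑ i ∈ Finset.range (m + 1), -((p.coeff i : K) * x ^ i) := by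
      rw [Finset.sum_neg_distrib]
      simpa using eq_neg_of_add_eq_zero_left h0
    rw [h2, Rat.cast_sum, Finset.sum_mul]
    refine Finset.sum_le_sum fun i hi => ?_
    rw [Rat.cast_abs, ← neg_mul]
    exact mul_le_mul (neg_le_abs _) (pow_le_pow_right₀ hx (by simpa [Nat.lt_succ_iff] using hi))
      (by positivity) (abs_nonneg _)
  have hle' : x ≤ (∑ i ∈ Finset.range (m + 1), |p.coeff i| : ℚ) := by
    rw [pow_succ, mul_comm] at hle
    exact le_of_mul_le_mul_right hle (by positivity)
  obtain ⟨n, hn⟩ := exists_nat_ge (∑ i ∈ Finset.range (m + 1), |p.coeff i| : ℚ)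
  exact ⟨n, hle'.trans (by exact_mod_cast hn)⟩

/-- Artin: in an algebraic extension of `ℚ`, an element that is nonnegative under all real
embeddings is a sum of squares. -/
theorem isSumSq_of_forall_ringHom_real_nonneg {K : Type*} [Field K] [CharZero K]
    (halg : ∀ x : K, IsAlgebraic ℚ x) {b : K} (hb : ∀ φ : K →+* ℝ, 0 ≤ φ b) : IsSumSq b := by
  classical
  by_contra hns
  have hsq : ∀ z : K, z * z ∈ Subsemiring.sumSq K := fun z => by simp
  have h1 : -1 ∉ Subsemiring.sumSq K := by
    intro h
    rw [Subsemiring.mem_sumSq] at h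
    -- Every element is a difference of two squares, so if `-1` were a sum of squares, `b` would be
    -- one.
    have : b = ((b + 1) / 2) * ((b + 1) / 2) + -1 * (((b - 1) / 2) * ((b - 1) / 2)) := by ring
    rw [this] at hns
    exact hns ((IsSumSq.mul_self _).add (h.mul (IsSumSq.mul_self _)))
  have hT : -1 ∉ (Subsemiring.sumSq K).adjoinElement hsq (-b) := fun h =>
    hns (by simpa using
      (Subsemiring.sumSq K).neg_mem_of_neg_one_mem_adjoinElement hsq h1 h)
  have hle : Subsemiring.sumSq K ≤ (Subsemiring.sumSq K).adjoinElement hsq (-b) :=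
    fun u hu => ⟨u, hu, 0, Subsemiring.zero_mem _, by ring⟩
  obtain ⟨C, hTC, hC1, hCsq, hCtot⟩ :=
    Subsemiring.exists_le_total _ (fun z => hle (hsq z)) hT
  have hbC : -b ∈ C := hTC ⟨0, Subsemiring.zero_mem _, 1, Subsemiring.one_mem _, by ring⟩
  -- A total preordering without `-1` is the nonnegative cone of a field order. That order is
  -- archimedean, so it comes from a real embedding, at which `b ≤ 0`.
  let D : RingCone K :=
    { C with
      eq_zero_of_mem_of_neg_mem' := by
        intro t ht hnt
        by_contra ht0
        refine hC1 ?_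
        have : (-1 : K) = -t * t * (t⁻¹ * t⁻¹) := by field_simp
        rw [this]
        exact C.mul_mem (C.mul_mem hnt ht) (hCsq _) }
  have : HasMemOrNegMem D := ⟨hCtot⟩
  let _ : LinearOrder K := LinearOrder.mkOfAddGroupCone D
  have : IsOrderedRing K := IsOrderedRing.mkOfCone D
  have : IsStrictOrderedRing K := IsOrderedRing.toIsStrictOrderedRing K
  have : Archimedean K := archimedean_of_isAlgebraic_rat K halg
  obtain ⟨φ⟩ := Real.nonemptyOrderRingHom K
  have hb0 : b ≤ 0 := show 0 - b ∈ C by simpa using hbC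
  have h3 : φ b ≤ φ 0 := φ.monotone' hb0
  have h4 : φ b = 0 := le_antisymm (by simpa using h3) (hb φ.toRingHom)
  have h5 : b = 0 := (map_eq_zero φ.toRingHom).1 h4
  exact hns (h5 ▸ IsSumSq.zero)

open IntermediateField

/-! ### Descent of the pythagorean property -/

theorem IsPythagoreanField.of_ringEquiv {K L : Type*} [Field K] [Field L] (e : K ≃+* L)
    (hL : IsPythagoreanField L) : IsPythagoreanField K := by
  intro x hx
  have h : IsSumSq (e x) := by
    induction hx using IsSumSq.rec' with
    | zero => simp
    | sq_add hx _ ih =>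
      rw [map_add]
      exact (hx.map e).isSumSq.add ih
  simpa using (hL _ h).map e.symm

/-- It suffices to check sums of the form `1 + u ^ 2`. -/
theorem isPythagoreanField_of_forall_one_add_sq {K : Type*} [Field K]
    (h : ∀ u : K, IsSquare (1 + u ^ 2)) : IsPythagoreanField K := by
  intro x hx
  induction hx using IsSumSq.rec' with
  | zero => simp
  | @sq_add x s hx _ ih =>
    obtain ⟨v, rfl⟩ := hx
    obtain ⟨w, rfl⟩ := ih
    by_cases hv : v = 0
    · exact ⟨w, by rw [hv]; ring⟩
    · have : v * v + w * w = v * v * (1 + (w / v) ^ 2) := by field_simp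
      rw [this]
      exact (IsSquare.mul_self v).mul (h _)

/-- Elements of the compositum of `K` with a field generated by a square root of an element of
`K`. -/
theorem IntermediateField.exists_eq_add_mul_of_mem_sup_adjoin {F L : Type*} [Field F] [Field L]
    [Algebra F L] (K : IntermediateField F L) {s : L} (hs : s ^ 2 ∈ K) {w : L}
    (hw : w ∈ K ⊔ adjoin F {s}) : ∃ x ∈ K, ∃ y ∈ K, w = x + y * s := by
  let N : IntermediateField F L :=
    { carrier := {w | ∃ x ∈ K, ∃ y ∈ K, w = x + y * s}
      mul_mem' := by
        rintro _ _ ⟨x, hx, y, hy, rfl⟩ ⟨u, hu, v, hv, rfl⟩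
        exact ⟨x * u + y * v * s ^ 2, add_mem (mul_mem hx hu) (mul_mem (mul_mem hy hv) hs),
          x * v + y * u, add_mem (mul_mem hx hv) (mul_mem hy hu), by ring⟩
      add_mem' := by
        rintro _ _ ⟨x, hx, y, hy, rfl⟩ ⟨u, hu, v, hv, rfl⟩
        exact ⟨x + u, add_mem hx hu, y + v, add_mem hy hv, by ring⟩
      algebraMap_mem' := fun r => ⟨_, K.algebraMap_mem r, 0, zero_mem K, by ring⟩
      inv_mem' := by
        rintro _ ⟨x, hx, y, hy, rfl⟩
        by_cases h : x ^ 2 - y ^ 2 * s ^ 2 = 0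
        · by_cases h0 : x + y * s = 0
          · exact ⟨0, zero_mem K, 0, zero_mem K, by simp [h0]⟩
          -- The norm can vanish at a nonzero element when `s ∈ K`; then `x = y * s` and the element
          -- is `x + x`.
          · have h1 : x - y * s = 0 :=
              (mul_eq_zero.1 (show (x + y * s) * (x - y * s) = 0 by
                linear_combination h)).resolve_left h0
            exact ⟨(x + x)⁻¹, inv_mem (add_mem hx hx), 0, zero_mem K, by
              rw [← sub_eq_zero.1 h1]; ring⟩
        · have h0 : x + y * s ≠ 0 := fun h0 => h (by linear_combination (x - y * s) * h0)
          refine ⟨x * (x ^ 2 - y ^ 2 * s ^ 2)⁻¹, ?_, -y * (x ^ 2 - y ^ 2 * s ^ 2)⁻¹, ?_, ?_⟩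
          · exact mul_mem hx (inv_mem (sub_mem (pow_mem hx 2) (mul_mem (pow_mem hy 2) hs)))
          · exact mul_mem (neg_mem hy)
              (inv_mem (sub_mem (pow_mem hx 2) (mul_mem (pow_mem hy 2) hs)))
          · field_simp
            ring }
  have hle : K ⊔ adjoin F {s} ≤ N := by
    refine sup_le (fun x hx => ⟨x, hx, 0, zero_mem K, by ring⟩) (adjoin_le_iff.2 ?_)
    rintro _ rfl
    exact ⟨0, zero_mem K, 1, one_mem K, by ring⟩
  exact hle hw

/-- Diller–Dress: a field of characteristic zero with a finite pythagorean extension is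
pythagorean. -/
theorem IsPythagoreanField.of_finiteDimensional (F : Type*) {L : Type*} [Field F] [Field L]
    [CharZero L] [Algebra F L] [FiniteDimensional F L] (hL : IsPythagoreanField L) :
    IsPythagoreanField F := by
  suffices h : ∀ K : IntermediateField F L, IsPythagoreanField K from
    (h ⊥).of_ringEquiv (botEquiv F L).symm.toRingEquiv
  intro K
  have : WellFoundedGT (IntermediateField F L) :=
    StrictMono.wellFoundedGT (f := fun K : IntermediateField F L => K.toSubalgebra.toSubmodule)
      fun _ _ h => h
  -- Induction downwards from `L`: all strictly larger intermediate fields are already pythagorean.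
  induction K using WellFoundedGT.induction with
  | ind K ih =>
  refine isPythagoreanField_of_forall_one_add_sq fun u => ?_
  by_contra hd
  have hu : (u : L) ≠ 0 := by
    rintro hu
    refine hd ⟨1, ?_⟩
    rw [Subtype.ext_iff]
    simp [hu]
  obtain ⟨s, hs⟩ : IsSquare (1 + (u : L) ^ 2) :=
    hL _ (IsSumSq.one.add (by rw [sq]; exact IsSumSq.mul_self _))
  have hsK : s ∉ K := fun h => hd ⟨⟨s, h⟩, Subtype.ext (by simpa using hs)⟩
  have hs2 : s ^ 2 = 1 + (u : L) ^ 2 := by rw [hs, sq]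
  have hs2K : s ^ 2 ∈ K := by
    rw [hs2]
    exact add_mem (one_mem K) (pow_mem u.2 2)
  have hsN : s ∈ K ⊔ adjoin F {s} :=
    le_sup_right (a := K) (mem_adjoin_simple_self F s)
  have huN : (u : L) ∈ K ⊔ adjoin F {s} := le_sup_left (a := K) u.2
  have hlt : K < K ⊔ adjoin F {s} :=
    lt_of_le_of_ne le_sup_left fun h => hsK (h ▸ hsN)
  let s' : ↥(K ⊔ adjoin F {s}) := ⟨s, hsN⟩
  let u' : ↥(K ⊔ adjoin F {s}) := ⟨u, huN⟩
  have hs' : s' ^ 2 = 1 + u' ^ 2 := Subtype.ext hs2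
  -- With `s = √(1 + u ^ 2)`, the element `s ^ 2 + s` is a sum of squares in `K(s)`, and its norm to
  -- `K` is `s ^ 4 - s ^ 2 = s ^ 2 * u ^ 2`. If it is a square in `K(s)`, its norm is a square in
  -- `K`, and hence so is `s ^ 2 = 1 + u ^ 2`.
  obtain ⟨w, hw⟩ : IsSquare (s' ^ 2 + s') := ih _ hlt _ (by
    have : s' ^ 2 + s' = ((1 + s') / 2) * ((1 + s') / 2) + ((1 + s') / 2) * ((1 + s') / 2) +
        (u' / 2 * (u' / 2) + u' / 2 * (u' / 2)) := by
      linear_combination (1 / 2) * hs'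
    rw [this]
    exact ((IsSumSq.mul_self _).add (IsSumSq.mul_self _)).add
      ((IsSumSq.mul_self _).add (IsSumSq.mul_self _)))
  obtain ⟨x, hx, y, hy, hxy⟩ := K.exists_eq_add_mul_of_mem_sup_adjoin hs2K w.2
  have hw' : s ^ 2 + s = (x + y * s) * (x + y * s) := by
    rw [← hxy]
    exact congrArg Subtype.val hw
  -- Compare coefficients of `s`, using `s ∉ K`.
  have h2 : 2 * x * y = 1 := by
    by_contra h
    have h0 : 1 - 2 * x * y ≠ 0 := fun h0 => h (by linear_combination -h0)
    refine hsK ?_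
    have : s = (x ^ 2 + y ^ 2 * s ^ 2 - s ^ 2) * (1 - 2 * x * y)⁻¹ := by
      rw [eq_mul_inv_iff_mul_eq₀ h0]
      linear_combination hw'
    rw [this]
    exact mul_mem (sub_mem (add_mem (pow_mem hx 2) (mul_mem (pow_mem hy 2) hs2K)) hs2K)
      (inv_mem (sub_mem (one_mem K)
        (mul_mem (mul_mem (ofNat_mem K 2) hx) hy)))
  have h3 : x ^ 2 + y ^ 2 * s ^ 2 = s ^ 2 := by linear_combination -hw' - s * h2
  have h4 : s ^ 2 * u ^ 2 = (x ^ 2 - y ^ 2 * s ^ 2) ^ 2 := by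
    linear_combination (-(s ^ 2)) * hs2 - (x ^ 2 + y ^ 2 * s ^ 2 + s ^ 2) * h3
      + s ^ 2 * (2 * x * y + 1) * h2
  refine hd ⟨⟨(x ^ 2 - y ^ 2 * s ^ 2) * (u : L)⁻¹, mul_mem (sub_mem (pow_mem hx 2)
    (mul_mem (pow_mem hy 2) hs2K)) (inv_mem u.2)⟩, Subtype.ext ?_⟩
  change 1 + (u : L) ^ 2 = _ * _
  rw [← hs2]
  field_simp
  linear_combination h4

/-! ### Quadratic extensions and separation of real embeddings -/

/-- A quadratic extension in characteristic zero is generated by a square root. -/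
theorem exists_sqrt_of_finrank_eq_two {F M : Type*} [Field F] [Field M] [CharZero F]
    [Algebra F M] (h2 : Module.finrank F M = 2) :
    ∃ (a : F) (s : M), ¬ IsSquare a ∧ s ^ 2 = algebraMap F M a ∧
      ∀ w : M, ∃ x y : F, w = algebraMap F M x + algebraMap F M y * s := by
  obtain ⟨t, ht⟩ : ∃ t : M, t ∉ (⊥ : IntermediateField F M) := by
    by_contra! h
    have : (⊥ : IntermediateField F M) = ⊤ := eq_top_iff.2 fun t _ => h t
    rw [bot_eq_top_iff_finrank_eq_one] at this
    omega
  have hli : LinearIndependent F ![(1 : M), t] := by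
    rw [LinearIndependent.pair_iff]
    intro p q hpq
    have hq : q = 0 := by
      by_contra hq
      refine ht (mem_bot.2 ⟨-p / q, ?_⟩)
      have hq' : algebraMap F M q ≠ 0 := by simpa using hq
      simp only [Algebra.smul_def] at hpq
      rw [map_div₀, map_neg]
      field_simp
      linear_combination -hpq
    subst hq
    simpa using hpq
  have hspan : ∀ w : M, ∃ x y : F, w = algebraMap F M x + algebraMap F M y * t := by
    intro w
    have h := hli.span_eq_top_of_card_eq_finrank (by simp [h2])
    have hw : w ∈ Submodule.span F (Set.range ![(1 : M), t]) := h ▸ Submodule.mem_top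
    simp only [Matrix.range_cons, Matrix.range_empty, Set.union_empty, Set.singleton_union] at hw
    obtain ⟨x, y, rfl⟩ := Submodule.mem_span_pair.1 hw
    exact ⟨x, y, by simp [Algebra.smul_def]⟩
  obtain ⟨p, q, hpq⟩ := hspan (t ^ 2)
  have hs : (t - algebraMap F M (q / 2)) ^ 2 = algebraMap F M (p + q ^ 2 / 4) := by
    have : CharZero M := charZero_of_injective_algebraMap (algebraMap F M).injective
    simp only [map_add, map_div₀, map_pow, map_ofNat]
    linear_combination hpq
  refine ⟨p + q ^ 2 / 4, t - algebraMap F M (q / 2), ?_, hs, fun w => ?_⟩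
  · rintro ⟨r, hr⟩
    rw [hr, map_mul, ← sq, sq_eq_sq_iff_eq_or_eq_neg] at hs
    rcases hs with hs | hs
    · exact ht (mem_bot.2 ⟨r + q / 2, by rw [map_add]; linear_combination -hs⟩)
    · exact ht (mem_bot.2 ⟨-r + q / 2, by rw [map_add, map_neg]; linear_combination -hs⟩)
  · obtain ⟨x, y, rfl⟩ := hspan w
    exact ⟨x + y * (q / 2), y, by simp only [map_add, map_mul]; ring⟩

/-- Two distinct real embeddings of an algebraic extension of `ℚ` at which `a` is negative are
separated by an element that is positive at all real embeddings at which `a` is positive. -/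
theorem exists_separating_real_embeddings {F : Type*} [Field F] [CharZero F]
    (halg : ∀ x : F, IsAlgebraic ℚ x) {a : F} {φ₁ φ₂ : F →+* ℝ} (hne : φ₁ ≠ φ₂)
    (h₁ : φ₁ a < 0) (h₂ : φ₂ a < 0) :
    ∃ b : F, 0 < φ₁ b ∧ φ₂ b < 0 ∧ ∀ ψ : F →+* ℝ, 0 < ψ a → 0 < ψ b := by
  obtain ⟨c, hc₁, hc₂⟩ : ∃ c : F, 0 < φ₁ c ∧ φ₂ c < 0 := by
    obtain ⟨c, hc⟩ : ∃ c, φ₁ c ≠ φ₂ c := by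
      by_contra! h
      exact hne (RingHom.ext h)
    rcases lt_or_gt_of_ne hc with hc | hc
    · obtain ⟨q, hq₁, hq₂⟩ := exists_rat_btwn hc
      exact ⟨q - c, by simpa using hq₁, by simpa using hq₂⟩
    · obtain ⟨q, hq₁, hq₂⟩ := exists_rat_btwn hc
      exact ⟨c - q, by simpa using hq₂, by simpa using hq₁⟩
  obtain ⟨r, hr⟩ := exists_nat_gt (max (-φ₁ a) (-φ₂ a))
  have hr₁ : -φ₁ a < r := (le_max_left _ _).trans_lt hr
  have hr₂ : -φ₂ a < r := (le_max_right _ _).trans_lt hr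
  have hr0 : (0 : ℝ) < r := by linarith
  -- The factor `1 + t / r` lies in `(0, 1)` at `φ₁ a` and `φ₂ a`, and exceeds `1` for `t > 0`. So
  -- for large `n` the element `c + g(a) ^ n` keeps the signs of `c` at `φ₁`, `φ₂` and is positive
  -- where `a` is.
  let g : ℝ → ℝ := fun t => (t + r) / r
  have hg0 : ∀ φ : F →+* ℝ, φ a < 0 → -φ a < r → Filter.Tendsto (fun n => g (φ a) ^ n)
      Filter.atTop (nhds 0) := fun φ h h' =>
    tendsto_pow_atTop_nhds_zero_of_lt_one (div_nonneg (by linarith) hr0.le)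
      ((div_lt_one hr0).2 (by linarith))
  -- There may be infinitely many embeddings, but `a` and `c` take finitely many real values, so a
  -- single `n` suffices.
  have hroots : ∀ x : F, (Set.range fun ψ : F →+* ℝ => ψ x).Finite := fun x => by
    refine ((minpoly ℚ x).rootSet_finite ℝ).subset ?_
    rintro _ ⟨ψ, rfl⟩
    rw [Polynomial.mem_rootSet]
    refine ⟨minpoly.ne_zero (halg x).isIntegral, ?_⟩
    have := Polynomial.aeval_algHom_apply ψ.toRatAlgHom x (minpoly ℚ x)
    simpa using this
  have hlarge : ∀ᶠ n in Filter.atTop, ∀ t ∈ Set.range fun ψ : F →+* ℝ => ψ a,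
      ∀ u ∈ Set.range fun ψ : F →+* ℝ => ψ c, 0 < t → 0 < u + g t ^ n := by
    rw [(hroots a).eventually_all]
    intro t _
    rw [(hroots c).eventually_all]
    intro u _
    by_cases ht : 0 < t
    · filter_upwards [(tendsto_pow_atTop_atTop_of_one_lt
        ((one_lt_div hr0).2 (by linarith : (r : ℝ) < t + r))).eventually_gt_atTop (-u)]
        with n hn _
      change 0 < u + ((t + r) / r) ^ n
      linarith
    · exact Filter.Eventually.of_forall fun n h => absurd h ht
  obtain ⟨n, hn, hn₂, hn₁⟩ := (hlarge.and (((hg0 φ₂ h₂ hr₂).eventually_lt_const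
    (by linarith : 0 < -φ₂ c)).and ((hg0 φ₁ h₁ hr₁).eventually_const_lt
    (by linarith : -φ₁ c < 0)))).exists
  have hb : ∀ ψ : F →+* ℝ, ψ (c + ((a + r) / r) ^ n) = ψ c + g (ψ a) ^ n := fun ψ => by
    simp [g]
  refine ⟨c + ((a + r) / r) ^ n, ?_, ?_, fun ψ hψ => ?_⟩
  · rw [hb]; linarith
  · rw [hb]; linarith
  · rw [hb]
    exact hn _ ⟨ψ, rfl⟩ _ ⟨ψ, rfl⟩ hψ

/-- If adjoining `s = √a` to `F` gives a pythagorean field, then `a` is negative at no more than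
one real embedding of `F`. -/
theorem eq_of_neg_of_isPythagoreanField_quadratic {F M : Type*} [Field F] [Field M] [CharZero F]
    [CharZero M] [Algebra F M] (halg : ∀ x : M, IsAlgebraic ℚ x) (hM : IsPythagoreanField M) {a : F} {s : M}
    (hs : s ^ 2 = algebraMap F M a) (ha : ¬ IsSquare a)
    (hspan : ∀ w : M, ∃ x y : F, w = algebraMap F M x + algebraMap F M y * s)
    {φ₁ φ₂ : F →+* ℝ} (h₁ : φ₁ a < 0) (h₂ : φ₂ a < 0) : φ₁ = φ₂ := by
  by_contra hne
  have halgF : ∀ x : F, IsAlgebraic ℚ x := fun x =>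
    (isAlgebraic_algHom_iff (algebraMap F M).toRatAlgHom (algebraMap F M).injective).1 (halg _)
  obtain ⟨b, hb₁, hb₂, hb⟩ := exists_separating_real_embeddings halgF hne h₁ h₂
  -- At a real embedding of `M` the image of `a` is the nonzero square `ψ s ^ 2`, so `b` is positive
  -- there.
  obtain ⟨w, hw⟩ := hM (algebraMap F M b) (isSumSq_of_forall_ringHom_real_nonneg halg fun ψ => by
    refine (hb (ψ.comp (algebraMap F M)) ?_).le
    have ha0 : a ≠ 0 := by
      rintro rfl
      simp at h₁
    have hsa : (ψ.comp (algebraMap F M)) a = ψ s ^ 2 := by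
      rw [← map_pow, hs]; rfl
    refine lt_of_le_of_ne (hsa ▸ sq_nonneg _) (Ne.symm ?_)
    simpa using ha0)
  obtain ⟨x, y, rfl⟩ := hspan w
  have hxy : x * y = 0 := by
    by_contra hxy
    refine ha ⟨(b - x ^ 2 - y ^ 2 * a) / (2 * (x * y)), ?_⟩
    have h2 : algebraMap F M x * algebraMap F M y ≠ 0 := by
      rw [← map_mul]; simpa using hxy
    have hs' : s = algebraMap F M ((b - x ^ 2 - y ^ 2 * a) / (2 * (x * y))) := by
      simp only [map_div₀, map_sub, map_mul, map_pow, map_ofNat, ← hs]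
      have hx := left_ne_zero_of_mul h2
      have hy := right_ne_zero_of_mul h2
      field_simp
      linear_combination -hw
    apply (algebraMap F M).injective
    rw [map_mul, ← hs', ← hs, sq]
  have hb' : b = x ^ 2 + y ^ 2 * a := by
    apply (algebraMap F M).injective
    have hxy' : algebraMap F M x * algebraMap F M y = 0 := by rw [← map_mul, hxy, map_zero]
    rw [map_add, map_mul, map_pow, map_pow, ← hs]
    linear_combination hw + 2 * s * hxy'
  -- If `x = 0`, then `b = y ^ 2 * a` is not positive at `φ₁`; if `y = 0`, then `b = x ^ 2` is not
  -- negative at `φ₂`.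
  rcases mul_eq_zero.1 hxy with rfl | rfl
  · rw [hb'] at hb₁
    simp only [map_add, map_mul, map_pow, map_zero] at hb₁
    nlinarith [sq_nonneg (φ₁ y)]
  · rw [hb'] at hb₂
    simp only [map_add, map_mul, map_pow, map_zero] at hb₂
    nlinarith [sq_nonneg (φ₂ x)]

/-! ### Real embeddings above the pythagorean closure -/

/-- An embedding of the pythagorean closure into `ℂ` is real if it is real on the base field. -/
theorem pythClosure_im_eq_zero {E Ω : Type*} [Field E] [Field Ω] [Algebra E Ω]
    (g : pythClosure E Ω →+* ℂ) (hg : ∀ e : E, (g (algebraMap E (pythClosure E Ω) e)).im = 0)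
    (x : pythClosure E Ω) : (g x).im = 0 := by
  let Q : IntermediateField E (pythClosure E Ω) :=
    { Complex.ofRealHom.fieldRange.comap g with
      algebraMap_mem' := fun e => ⟨(g (algebraMap E (pythClosure E Ω) e)).re,
        Complex.ext (by simp) (by simp [hg])⟩ }
  have hQ : ∀ y, y ∈ Q ↔ (g y).im = 0 := fun y =>
    ⟨fun ⟨r, hr⟩ => by rw [← hr]; simp,
      fun h => ⟨(g y).re, Complex.ext (by simp) (by simp [h])⟩⟩
  have hlift : ∀ K, IsPythTower E Ω K → K ≤ lift Q := by
    intro K hK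
    induction hK with
    | base => exact bot_le
    | step K a b c hK ha hb hc ih =>
      refine sup_le ih (adjoin_le_iff.2 (Set.singleton_subset_iff.2 ?_))
      obtain ⟨a, haQ, rfl⟩ := ih ha
      obtain ⟨b, hbQ, rfl⟩ := ih hb
      have hcP : c ∈ pythClosure E Ω := mem_pythClosure_iff.2
        ⟨_, .step K _ _ c hK ha hb hc, le_sup_right (a := K) (mem_adjoin_simple_self E c)⟩
      refine ⟨⟨c, hcP⟩, (hQ _).2 ?_, rfl⟩
      have hcg : g ⟨c, hcP⟩ ^ 2 = g a ^ 2 + g b ^ 2 := by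
        simp only [← map_pow, ← map_add]
        exact congrArg g (Subtype.ext hc)
      have ha0 := (hQ a).1 haQ
      have hb0 := (hQ b).1 hbQ
      have hre := congrArg Complex.re hcg
      have him := congrArg Complex.im hcg
      simp only [sq, Complex.add_re, Complex.add_im, Complex.mul_re, Complex.mul_im, ha0, hb0]
        at hre him
      -- A nonreal `g c` with real square is purely imaginary, so its square is negative, yet it
      -- equals a sum of two real squares.
      by_contra h0
      have hre0 : (g ⟨c, hcP⟩).re = 0 := by
        have : (g ⟨c, hcP⟩).re * (g ⟨c, hcP⟩).im = 0 := by linarith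
        exact (mul_eq_zero.1 this).resolve_right h0
      rw [hre0] at hre
      have := mul_self_pos.2 h0
      nlinarith [mul_self_nonneg (g a).re, mul_self_nonneg (g b).re]
  obtain ⟨K, hK, hxK⟩ := mem_pythClosure_iff.1 x.2
  obtain ⟨y, hy, hyx⟩ := hlift K hK hxK
  have : y = x := Subtype.ext hyx
  exact (hQ x).1 (this ▸ hy)

/-- A finite pythagorean extension of the pythagorean closure of a field that is not pythagorean
has, along with each real embedding, another one with the same value at a given element. -/
theorem exists_ne_real_embedding {E Ω F : Type*} [Field E] [Field Ω] [Algebra E Ω]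
    [Algebra.IsAlgebraic E Ω] [Field F] [CharZero F] [Algebra (pythClosure E Ω) F]
    [FiniteDimensional (pythClosure E Ω) F] [Algebra E F] [IsScalarTower E (pythClosure E Ω) F]
    (hE : ¬ IsPythagoreanField E) (hF : IsPythagoreanField F) (φ : F →+* ℝ) (a : F) :
    ∃ φ' : F →+* ℝ, φ' ≠ φ ∧ φ' a = φ a := by
  have : CharZero (pythClosure E Ω) := by
    refine ⟨fun m n h => ?_⟩
    have := congrArg (algebraMap (pythClosure E Ω) F) h
    simpa using this
  obtain ⟨θ, hθ⟩ := Field.exists_primitive_element (pythClosure E Ω) F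
  have : Algebra.IsAlgebraic E F := Algebra.IsAlgebraic.trans E (pythClosure E Ω) F
  -- Including `θ` forces any embedding that agrees with `φ` on `N` to be real on all of `F`;
  -- including `a` preserves its value.
  let N : IntermediateField E F := adjoin E {θ, a}
  have hθN : θ ∈ N := subset_adjoin E _ (by simp)
  have haN : a ∈ N := subset_adjoin E _ (by simp)
  have : FiniteDimensional E N :=
    finiteDimensional_adjoin fun x _ => (Algebra.IsAlgebraic.isAlgebraic x).isIntegral
  obtain ⟨y, hy⟩ : ∃ y, y ∉ N := by
    by_contra! h
    have hN : N = ⊤ := eq_top_iff.2 fun x _ => h x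
    refine hE (IsPythagoreanField.of_finiteDimensional E (L := N) ?_)
    rw [hN]
    exact hF.of_ringEquiv topEquiv.toRingEquiv
  let _ : Algebra N ℂ := ((Complex.ofRealHom.comp φ).comp (algebraMap N F)).toAlgebra
  have hmapN : ∀ x : N, algebraMap N ℂ x = (φ x : ℂ) := fun x => rfl
  have : Algebra.IsAlgebraic N F := Algebra.IsAlgebraic.tower_top (K := E) N
  -- As `y ∉ N`, its separable minimal polynomial over `N` has a root in `ℂ` other than `φ y`.
  obtain ⟨τ, hτ⟩ : ∃ τ : F →ₐ[N] ℂ, τ y ≠ φ y := by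
    by_contra! h
    have hint : IsIntegral N y := (Algebra.IsAlgebraic.isAlgebraic (R := N) y).isIntegral
    have hroot := Algebra.IsAlgebraic.range_eval_eq_rootSet_minpoly (F := N) (K := F) ℂ y
    have hcard := Polynomial.card_rootSet_eq_natDegree (K := ℂ)
      (minpoly.irreducible hint).separable (IsAlgClosed.splits _)
    have hsub : (minpoly N y).rootSet ℂ ⊆ {(φ y : ℂ)} := by
      rw [← hroot]
      rintro _ ⟨ψ, rfl⟩
      exact h ψ
    have hle : (minpoly N y).natDegree ≤ 1 := by
      rw [← hcard, ← Nat.card_eq_fintype_card, Nat.card_coe_set_eq]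
      exact (Set.ncard_le_ncard hsub).trans (by simp)
    have h1 : (minpoly N y).natDegree = 1 := le_antisymm hle (minpoly.natDegree_pos hint)
    obtain ⟨z, hz⟩ := minpoly.mem_range_of_degree_eq_one N y
      ((Polynomial.degree_eq_iff_natDegree_eq_of_pos one_pos).2 h1)
    exact hy (hz ▸ z.2)
  have hτN : ∀ x (hx : x ∈ N), τ x = φ x := fun x hx => (τ.commutes ⟨x, hx⟩).trans (hmapN _)
  let R : IntermediateField (pythClosure E Ω) F :=
    { Complex.ofRealHom.fieldRange.comap (τ : F →+* ℂ) with
      algebraMap_mem' := fun x => by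
        have h := pythClosure_im_eq_zero
          ((τ : F →+* ℂ).comp (algebraMap (pythClosure E Ω) F)) (fun e => by
            rw [RingHom.comp_apply, ← IsScalarTower.algebraMap_apply]
            have := hτN _ (N.algebraMap_mem e)
            simp [this]) x
        exact ⟨_, Complex.ext (Complex.ofReal_re _) ((Complex.ofReal_im _).trans h.symm)⟩ }
  have hR : ∀ x, x ∈ R := by
    have : R = ⊤ := by
      rw [eq_top_iff, ← hθ, adjoin_simple_le_iff]
      exact ⟨φ θ, (hτN θ hθN).symm⟩
    intro x
    rw [this]
    trivial
  have him : ∀ x, ((τ x).re : ℂ) = τ x := fun x => by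
    obtain ⟨r, hr⟩ := hR x
    have hr' : (r : ℂ) = τ x := hr
    rw [← hr', Complex.ofReal_re]
  refine ⟨{ toFun := fun x => (τ x).re
            map_one' := by simp
            map_zero' := by simp
            map_add' := by simp
            map_mul' := fun x z => Complex.ofReal_injective (by
              rw [Complex.ofReal_mul, him, him, him, map_mul]) }, ?_, ?_⟩
  · intro h
    refine hτ ?_
    rw [← him]
    exact congrArg _ (RingHom.congr_fun h y)
  · change (τ a).re = φ a
    rw [hτN a haN, Complex.ofReal_re]

/-! ### Conclusion -/

theorem mainTheorem9
    (E : Type*) [Field E] [Algebra ℚ E] [Algebra.IsAlgebraic ℚ E]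
    (hreal : IsSemireal E) (hE : ¬ IsPythagoreanField E)
    (Ω : Type*) [Field Ω] [Algebra E Ω] [IsAlgClosure E Ω]
    (L : Type*) [Field L] [Algebra (pythClosure E Ω) L]
    [FiniteDimensional (pythClosure E Ω) L]
    (n : ℕ) (F : Fin (n + 1) → IntermediateField (pythClosure E Ω) L)
    (hmono : Monotone F) (hbot : F 0 = ⊥) (htop : F (Fin.last n) = ⊤)
    (i : Fin n) (hquad : IntermediateField.relfinrank (F i.castSucc) (F i.succ) = 2) :
    ¬ IsPythagoreanField L := by
  intro hL
  have : CharZero E := algebraRat.charZero E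
  have : CharZero (pythClosure E Ω) :=
    charZero_of_injective_algebraMap (algebraMap E (pythClosure E Ω)).injective
  have : CharZero L :=
    charZero_of_injective_algebraMap (algebraMap (pythClosure E Ω) L).injective
  have : Algebra.IsAlgebraic E Ω := IsAlgClosure.isAlgebraic
  have halg : ∀ x : L, IsAlgebraic ℚ x := by
    have : Algebra.IsAlgebraic ℚ (pythClosure E Ω) := Algebra.IsAlgebraic.trans ℚ E _
    have : Algebra.IsAlgebraic ℚ L := Algebra.IsAlgebraic.trans ℚ (pythClosure E Ω) L
    exact fun x => Algebra.IsAlgebraic.isAlgebraic x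
  have hle : F i.castSucc ≤ F i.succ := hmono i.castSucc_lt_succ.le
  rw [relfinrank_eq_finrank_of_le hle] at hquad
  obtain ⟨a, s, ha, hs, hspan⟩ := exists_sqrt_of_finrank_eq_two hquad
  have hM : IsPythagoreanField (extendScalars hle) :=
    IsPythagoreanField.of_finiteDimensional _ (L := L) hL
  have hF : IsPythagoreanField (F i.castSucc) :=
    IsPythagoreanField.of_finiteDimensional _ (L := L) hL
  -- Otherwise Artin's theorem makes `a` a sum of squares, hence a square in the pythagorean field
  -- `F i.castSucc`.
  obtain ⟨φ, hφ⟩ : ∃ φ : F i.castSucc →+* ℝ, φ a < 0 := by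
    by_contra! h
    exact ha (hF _ (isSumSq_of_forall_ringHom_real_nonneg
      (fun x => (isAlgebraic_algHom_iff (F i.castSucc).val.toRingHom.toRatAlgHom
        Subtype.val_injective).1 (halg x)) h))
  let _ : Algebra E (F i.castSucc) :=
    ((algebraMap (pythClosure E Ω) (F i.castSucc)).comp
      (algebraMap E (pythClosure E Ω))).toAlgebra
  have : IsScalarTower E (pythClosure E Ω) (F i.castSucc) := .of_algebraMap_eq fun _ => rfl
  obtain ⟨φ', hne, hφ'⟩ := exists_ne_real_embedding (Ω := Ω) hE hF φ a
  refine hne (eq_of_neg_of_isPythagoreanField_quadratic (fun x => ?_) hM hs ha hspan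
    (hφ'.trans_lt hφ) hφ)
  exact (isAlgebraic_algHom_iff (extendScalars hle).val.toRingHom.toRatAlgHom
    Subtype.val_injective).1 (halg x)
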